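/- Let $\mathcal H$ be a finite-dimensional complex Hilbert space and, for each $n\ge 1$, let $\rho_n,\sigma_n$ be faithful states on $\mathcal H^{\otimes n}$ (strictly positive operators of trace one). Assume that for some $R\ge 1$ both sequences satisfy the homogeneous upper factorization property $$\rho_n\le R\,\rho_{n-1}\otimes\rho_1,\qquad \sigma_n\le R\,\sigma_{n-1}\otimes\sigma_1\qquad(n>1).$$ For a test $0\le T\le \mathbb I$ on $\mathcal H^{\otimes n}$ put $\alpha(T)=\operatorname{Tr}[(\mathbb I-T)\rho_n]$ and $\beta(T)=\operatorname{Tr}[T\sigma_n]$, and define the Stein and Hoeffding errors $$\beta_n(\varepsilon)=\inf_{0\le T\le\mathbb I}\{\beta(T):\alpha(T)\le\varepsilon\},\qquad \tilde\beta_n(r)=\inf_{0\le T\le\mathbb I}\{\beta(T):\alpha(T)\le e^{-nr}\}.$$ Let $D=D(\rho_1\|\sigma_1)=\operatorname{Tr}\rho_1(\log\rho_1-\log\sigma_1)$. Let $\Delta_{\sigma_1|\rho_1}:A\mapsto\sigma_1A\rho_1^{-1}$ be the relative modular operator on the space $\mathcal B(\mathcal H)$ equipped with the Hilbert--Schmidt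 inner product $\langle A,B\rangle=\operatorname{Tr}(A^*B)$, and let $c=\|\log\Delta_{\sigma_1|\rho_1}+D\,\mathrm{id}\|$ (operator norm). Then for every $n\ge 1$ the following hold. For every $0<\varepsilon\le 1$, $$\beta_n(\varepsilon)\le\begin{cases} e^{-nD+c\sqrt{2n\log(R^n\varepsilon^{-1})}} & \text{if }\varepsilon\ge R^ne^{-nc^2/2},\\ e^{-nD+nc^2/2+\log(R^n\varepsilon^{-1})} & \text{otherwise.}\end{cases}$$ For every $r>0$, $$\tilde\beta_n(r)\le\begin{cases} e^{-nD+nc\sqrt{2(r+\log R)}} & \text{if } r\le c^2/2-\log R,\\ e^{-n(D-c^2/2-r-\log R)} & \text{otherwise.}\end{cases}$$ -/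

import Mathlib

open scoped MatrixOrder ComplexOrder Kronecker

/-- A faithful state on `ℂ^m`: a strictly positive matrix of trace one. -/
structure IsFaithfulState {m : Type*} [Fintype m] (ρ : Matrix m m ℂ) : Prop where
  posDef : ρ.PosDef
  trace_eq_one : ρ.trace = 1

/-- The quantum relative entropy `D(ρ‖σ) = Tr ρ (log ρ - log σ)` (a real number for
faithful states); `log` is the functional calculus of the real logarithm. -/
noncomputable def relEntropy {m : Type*} [Fintype m] [DecidableEq m]
    (ρ σ : Matrix m m ℂ) : ℝ :=
  (ρ * (cfc Real.log ρ - cfc Real.log σ)).trace.re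

/-- The space of `m × m` complex matrices as a Hilbert space: the inner product is the
Hilbert-Schmidt one, see `HilbertSchmidt.inner_eq_trace`. -/
abbrev HilbertSchmidt (m : Type*) : Type _ := EuclideanSpace ℂ (m × m)

/-- The matrix with given entries, as a vector of the Hilbert-Schmidt space. -/
def HilbertSchmidt.equivMatrix (m : Type*) : HilbertSchmidt m ≃ₗ[ℂ] Matrix m m ℂ where
  toFun x := Matrix.of fun i j => x (i, j)
  invFun A := WithLp.toLp 2 fun p => A p.1 p.2
  map_add' _ _ := rfl
  map_smul' _ _ := rfl
  left_inv _ := rfl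
  right_inv _ := rfl

/-- The inner product of the Hilbert-Schmidt space is `⟨A, B⟩ = Tr (A* B)`. -/
theorem HilbertSchmidt.inner_eq_trace {m : Type*} [Fintype m] (A B : Matrix m m ℂ) :
    inner ℂ ((HilbertSchmidt.equivMatrix m).symm A) ((HilbertSchmidt.equivMatrix m).symm B)
      = (A.conjTranspose * B).trace := by
  simp only [PiLp.inner_apply, Matrix.trace, Matrix.diag,
    Matrix.mul_apply, Matrix.conjTranspose_apply, Fintype.sum_prod_type]
  rw [Finset.sum_comm]
  refine Finset.sum_congr rfl fun i _ => Finset.sum_congr rfl fun j _ => ?_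
  exact mul_comm (B j i) (star (A j i))

/-- The relative modular operator `Δ_{σ|ρ} : A ↦ σ A ρ⁻¹`, as an operator on the
Hilbert-Schmidt space. -/
noncomputable def relModular {m : Type*} [Fintype m] [DecidableEq m] (σ ρ : Matrix m m ℂ) :
    HilbertSchmidt m →L[ℂ] HilbertSchmidt m :=
  LinearMap.toContinuousLinearMap
    ((HilbertSchmidt.equivMatrix m).symm.toLinearMap ∘ₗ
      (LinearMap.mulLeft ℂ σ ∘ₗ LinearMap.mulRight ℂ ρ⁻¹) ∘ₗ
        (HilbertSchmidt.equivMatrix m).toLinearMap)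

/-- The constant `c = ‖log Δ_{σ|ρ} + D(ρ‖σ) id‖`, with the operator norm on the
Hilbert-Schmidt space. -/
noncomputable def modularDeviation {m : Type*} [Fintype m] [DecidableEq m]
    (ρ σ : Matrix m m ℂ) : ℝ :=
  ‖cfc Real.log (relModular σ ρ) +
    (relEntropy ρ σ : ℂ) • ContinuousLinearMap.id ℂ (HilbertSchmidt m)‖

/-- Type I error `Tr[(1 - T) ρ]` of the test `T`. -/
noncomputable def typeIError {m : Type*} [Fintype m] [DecidableEq m]
    (ρ T : Matrix m m ℂ) : ℝ :=
  ((1 - T) * ρ).trace.re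

/-- Type II error `Tr[T σ]` of the test `T`. -/
noncomputable def typeIIError {m : Type*} [Fintype m] (σ T : Matrix m m ℂ) : ℝ :=
  (T * σ).trace.re

/-- The Stein error: the infimum of the type II errors over all tests `0 ≤ T ≤ 1` whose type I
error is at most `ε`. -/
noncomputable def steinError {m : Type*} [Fintype m] [DecidableEq m]
    (ρ σ : Matrix m m ℂ) (ε : ℝ) : ℝ :=
  sInf {b : ℝ | ∃ T : Matrix m m ℂ, 0 ≤ T ∧ T ≤ 1 ∧ typeIError ρ T ≤ ε ∧ b = typeIIError σ T}

/-- The Hoeffding error at blocklength `n`: the infimum of the type II errors over all tests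
`0 ≤ T ≤ 1` whose type I error is at most `exp (-n r)`. -/
noncomputable def hoeffdingError {m : Type*} [Fintype m] [DecidableEq m] (n : ℕ)
    (ρ σ : Matrix m m ℂ) (r : ℝ) : ℝ :=
  sInf {b : ℝ | ∃ T : Matrix m m ℂ, 0 ≤ T ∧ T ≤ 1 ∧
    typeIError ρ T ≤ Real.exp (-(n * r)) ∧ b = typeIIError σ T}

/-- Operators on the `n`-fold tensor power of `H = ℂ^ι`, as matrices in the product basis, which
is indexed by `Fin n → ι`. -/
abbrev TensorPowerOp (ι : Type*) (n : ℕ) : Type _ := Matrix (Fin n → ι) (Fin n → ι) ℂ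

/-- The tensor product `A ⊗ B` of operators on `H^{⊗ n}` and `H^{⊗ k}`, on `H^{⊗ (n + k)}`. -/
def tensorOp {ι : Type*} {n k : ℕ} (A : TensorPowerOp ι n) (B : TensorPowerOp ι k) :
    TensorPowerOp ι (n + k) :=
  Matrix.reindex (Fin.appendEquiv n k) (Fin.appendEquiv n k) (A ⊗ₖ B)

/-- The homogeneous upper factorization property `ρ_n ≤ R ρ_{n-1} ⊗ ρ_1` for all `n > 1`
(written here with `n + 1` in place of `n`). -/
def UpperFactorization {ι : Type*} [Fintype ι] (R : ℝ)
    (ρ : (n : ℕ) → TensorPowerOp ι n) : Prop :=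
  ∀ n : ℕ, 1 ≤ n → ρ (n + 1) ≤ R • tensorOp (ρ n) (ρ 1)

/-! Audenaert's inequality (`exists_test_error_le`), applied to `ρ_n` and `exp (-y) σ_n`, bounds
both errors of one test through `Tr ρ_n^(1-s) σ_n^s`, `0 ≤ s ≤ 1`. Operator monotonicity of `x^s`
and `x^(1-s)` turns upper factorization into `Tr ρ_n^(1-s) σ_n^s ≤ R^n (Tr ρ_1^(1-s) σ_1^s)^n`.

The one-copy trace is classical: if `a_i, u_i` and `b_j, v_j` diagonalize `ρ_1` and `σ_1`, then `a_i
|⟨u_i, v_j⟩|²` is a probability distribution and the trace is the moment generating function of `log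
(b_j / a_i)` under it. This variable has mean `-D`, and stays within `c` of it because each `b_j /
a_i` is an eigenvalue of `Δ`. Hoeffding's lemma gives `exp (-s D + s² c² / 2)`.

Hence, with `L = log (R^n / ε)`, the Stein error is at most `exp (-n D + n s c² / 2 + L / s)` for `0
< s ≤ 1`. The two regimes are the interior minimum in `s` and the endpoint `s = 1`; the Hoeffding
error is the case `ε = exp (-n r)`. -/

namespace Matrix

/-! ### Trace inequalities and Audenaert's inequality -/

variable {m n : Type*} [Fintype m] [DecidableEq m] [Fintype n] [DecidableEq n]

/-- The trace of a product of two positive semidefinite matrices is nonnegative. -/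
theorem trace_mul_re_nonneg {P Q : Matrix m m ℂ} (hP : 0 ≤ P) (hQ : 0 ≤ Q) :
    0 ≤ (P * Q).trace.re := by
  obtain ⟨C, rfl⟩ := CStarAlgebra.nonneg_iff_eq_star_mul_self.mp hQ
  rw [← mul_assoc, trace_mul_comm, ← mul_assoc]
  exact (Complex.le_def.mp (nonneg_iff_posSemidef.mp
    (star_right_conjugate_nonneg hP C)).trace_nonneg).1

theorem trace_mul_re_mono_left {P P' Q : Matrix m m ℂ} (h : P ≤ P') (hQ : 0 ≤ Q) :
    (P * Q).trace.re ≤ (P' * Q).trace.re := by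
  have := trace_mul_re_nonneg (sub_nonneg.mpr h) hQ
  rw [sub_mul, trace_sub, Complex.sub_re] at this
  linarith

theorem trace_mul_re_mono_right {P Q Q' : Matrix m m ℂ} (h : Q ≤ Q') (hP : 0 ≤ P) :
    (P * Q).trace.re ≤ (P * Q').trace.re := by
  rw [trace_mul_comm P Q, trace_mul_comm P Q']
  exact trace_mul_re_mono_left h hP

/-- Operator monotonicity of `x ↦ x ^ s` for `s ∈ [0, 1]`. -/
theorem cfc_rpow_le_cfc_rpow {A B : Matrix m m ℂ} (hA : 0 ≤ A) (hAB : A ≤ B) {s : ℝ}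
    (hs : s ∈ Set.Icc (0 : ℝ) 1) :
    cfc (fun x : ℝ => x ^ s) A ≤ cfc (fun x : ℝ => x ^ s) B := by
  open scoped Matrix.Norms.L2Operator in
  have h := CFC.rpow_le_rpow hs hAB
  rwa [CFC.rpow_eq_cfc_real hA, CFC.rpow_eq_cfc_real (hA.trans hAB)] at h

theorem cfc_rpow_nonneg {A : Matrix m m ℂ} (hA : 0 ≤ A) (s : ℝ) :
    0 ≤ cfc (fun x : ℝ => x ^ s) A :=
  cfc_nonneg fun _ hx => Real.rpow_nonneg (spectrum_nonneg_of_nonneg hA hx) s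

theorem continuousOn_spectrum (A : Matrix m m ℂ) (f : ℝ → ℝ) : ContinuousOn f (spectrum ℝ A) :=
  A.finite_real_spectrum.continuousOn f

theorem cfc_rpow_one_sub_mul {A : Matrix m m ℂ} (hA : 0 ≤ A) (s : ℝ) :
    cfc (fun x : ℝ => x ^ s) A * cfc (fun x : ℝ => x ^ (1 - s)) A = A := by
  rw [← cfc_mul _ _ A (continuousOn_spectrum A _) (continuousOn_spectrum A _)]
  conv_rhs => rw [← cfc_id' ℝ A (.of_nonneg hA)]
  refine cfc_congr fun x hx => ?_
  have hx0 : 0 ≤ x := spectrum_nonneg_of_nonneg hA hx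
  -- A zero eigenvalue is harmless: the exponents sum to `1 ≠ 0`.
  rw [← Real.rpow_add' hx0 (by simp), add_sub_cancel, Real.rpow_one]

/-- Audenaert's inequality: some test has weighted error at most `Tr A ^ (1 - s) B ^ s`. -/
theorem exists_test_error_le {A B : Matrix m m ℂ} (hA : 0 ≤ A) (hB : 0 ≤ B) {s : ℝ}
    (hs : s ∈ Set.Icc (0 : ℝ) 1) :
    ∃ T : Matrix m m ℂ, 0 ≤ T ∧ T ≤ 1 ∧ ((1 - T) * A).trace.re + (T * B).trace.re ≤
      (cfc (fun x : ℝ => x ^ (1 - s)) A * cfc (fun x : ℝ => x ^ s) B).trace.re := by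
  have hsa : IsSelfAdjoint (A - B) := (IsSelfAdjoint.of_nonneg hA).sub (.of_nonneg hB)
  have hc := continuousOn_spectrum (A - B)
  -- The Neyman–Pearson test: the projection onto the positive part of `A - B`, so that `T * (A - B)
  -- = (A - B)₊`.
  set T : Matrix m m ℂ := cfc (fun x : ℝ => if 0 < x then 1 else 0) (A - B) with hT
  have hs' : 1 - s ∈ Set.Icc (0 : ℝ) 1 := ⟨by linarith [hs.2], by linarith [hs.1]⟩
  have hTpos : 0 ≤ T * (A - B) := by
    rw [hT]
    nth_rw 2 [← cfc_id' ℝ (A - B) hsa]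
    rw [← cfc_mul _ _ _ (hc _) (hc _)]
    refine cfc_nonneg fun x _ => ?_
    split_ifs with h
    · simpa using h.le
    · simp
  have hTge : A - B ≤ T * (A - B) := by
    conv_lhs => rw [← cfc_id' ℝ (A - B) hsa]
    rw [hT]
    nth_rw 3 [← cfc_id' ℝ (A - B) hsa]
    rw [← cfc_mul _ _ _ (hc _) (hc _)]
    refine cfc_mono (fun x _ => ?_) (hc _) (hc _)
    split_ifs with h
    · simp
    · simpa using not_lt.mp h
  refine ⟨T, cfc_nonneg fun x _ => by split_ifs <;> simp,
    cfc_le_one _ _ fun x _ => by split_ifs <;> simp, ?_⟩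
  set Δ := T * (A - B) with hΔ
  have hAB : A ≤ B + Δ := by rwa [sub_le_iff_le_add'] at hTge
  have hBΔ : B ≤ B + Δ := le_add_of_nonneg_right hTpos
  have hBΔ0 : 0 ≤ B + Δ := hB.trans hBΔ
  -- With `C = B + Δ ≥ A, B`, these give `Tr (A^s - B^s) A^(1-s) ≤ Tr (C^s - B^s) A^(1-s) ≤ Tr (C^s
  -- - B^s) C^(1-s) ≤ Tr C - Tr B = Tr Δ`.
  have h1 := trace_mul_re_mono_left (cfc_rpow_le_cfc_rpow hA hAB hs) (cfc_rpow_nonneg hA (1 - s))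
  have h2 := trace_mul_re_mono_right (cfc_rpow_le_cfc_rpow hA hAB hs')
    (sub_nonneg.mpr (cfc_rpow_le_cfc_rpow hB hBΔ hs))
  have h3 := trace_mul_re_mono_right (cfc_rpow_le_cfc_rpow hB hBΔ hs') (cfc_rpow_nonneg hB s)
  rw [cfc_rpow_one_sub_mul hA] at h1
  rw [cfc_rpow_one_sub_mul hB] at h3
  simp only [sub_mul, trace_sub, Complex.sub_re, cfc_rpow_one_sub_mul hBΔ0] at h2
  rw [trace_mul_comm (cfc _ A)]
  have h4 : Δ.trace.re = (T * A).trace.re - (T * B).trace.re := by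
    rw [hΔ, mul_sub, trace_sub, Complex.sub_re]
  simp only [sub_mul, trace_sub, Complex.sub_re, one_mul, trace_add, Complex.add_re] at *
  linarith

/-- The functional calculus of a matrix given by a unitary diagonalization. -/
theorem cfc_unitary_conj_diagonal (U : unitaryGroup m ℂ) (d : m → ℝ) (f : ℝ → ℝ) :
    cfc f ((U : Matrix m m ℂ) * diagonal (fun i => (d i : ℂ)) * star (U : Matrix m m ℂ)) =
      (U : Matrix m m ℂ) * diagonal (fun i => (f (d i) : ℂ)) * star (U : Matrix m m ℂ) := by
  classical
  let φ : Matrix m m ℂ ≃⋆ₐ[ℂ] Matrix m m ℂ := Unitary.conjStarAlgAut ℂ _ U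
  let ψ : (m → ℝ) →ₐ[ℝ] Matrix m m ℂ :=
    ((φ.toAlgEquiv.toAlgHom.comp (diagonalAlgHom ℂ)).restrictScalars ℝ).comp
      (AlgHom.compLeft (Algebra.ofId ℝ ℂ) m)
  have hψ (g : m → ℝ) : ψ g =
      (U : Matrix m m ℂ) * diagonal (fun i => (g i : ℂ)) * star (U : Matrix m m ℂ) := rfl
  have hsa (g : m → ℝ) : IsSelfAdjoint (ψ g) := by
    rw [hψ]
    refine IsSelfAdjoint.conjugate ?_ _
    rw [isSelfAdjoint_iff, star_eq_conjTranspose, diagonal_conjTranspose]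
    congr 1
    ext i
    simp
  have hspec : spectrum ℝ (ψ d) ⊆ Set.range d := by
    refine (AlgHom.spectrum_apply_subset ψ d).trans ?_
    rw [Pi.spectrum_eq]
    refine Set.iUnion_subset fun i x hx => ⟨i, ?_⟩
    by_contra hne
    exact hx (isUnit_iff_ne_zero.mpr (sub_ne_zero.mpr fun h => hne h.symm))
  rw [← hψ d, ← hψ fun i => f (d i)]
  -- The spectrum lies in the finite range of `d`, so `f` may be replaced by an interpolating
  -- polynomial, which commutes with the algebra homomorphism `ψ`.
  let p := Lagrange.interpolate (Finset.univ.image d) id f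
  have hp (i : m) : p.eval (d i) = f (d i) :=
    Lagrange.eval_interpolate_at_node (v := id) f Function.injective_id.injOn
      (Finset.mem_image_of_mem d (Finset.mem_univ i))
  have h1 : cfc f (ψ d) = cfc p.eval (ψ d) := by
    refine cfc_congr fun x hx => ?_
    obtain ⟨i, rfl⟩ := hspec hx
    exact (hp i).symm
  rw [h1, cfc_polynomial p _ (hsa d), Polynomial.aeval_algHom_apply]
  congr 1
  ext i
  rw [Polynomial.aeval_pi_apply₂]
  simpa using hp i

end Matrix

/-! ### Functional calculus of Kronecker products and eigenvector overlaps -/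

namespace Matrix

variable {m n : Type*} [Fintype m] [DecidableEq m] [Fintype n] [DecidableEq n]

theorem IsHermitian.eq_unitary_conj_diagonal {A : Matrix m m ℂ} (hA : A.IsHermitian) :
    A = (hA.eigenvectorUnitary : Matrix m m ℂ) * diagonal (fun i => (hA.eigenvalues i : ℂ)) *
      star (hA.eigenvectorUnitary : Matrix m m ℂ) :=
  hA.spectral_theorem

theorem IsHermitian.cfc_eq_unitary_conj_diagonal {A : Matrix m m ℂ} (hA : A.IsHermitian)
    (f : ℝ → ℝ) :
    cfc f A = (hA.eigenvectorUnitary : Matrix m m ℂ) *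
      diagonal (fun i => (f (hA.eigenvalues i) : ℂ)) *
      star (hA.eigenvectorUnitary : Matrix m m ℂ) :=
  hA.cfc_eq f

/-- The functional calculus of a multiplicative function is compatible with Kronecker products. -/
theorem cfc_kronecker {A : Matrix m m ℂ} {B : Matrix n n ℂ} (hA : A.PosSemidef)
    (hB : B.PosSemidef) {f : ℝ → ℝ} (hf : ∀ x y, 0 ≤ x → 0 ≤ y → f (x * y) = f x * f y) :
    cfc f (A ⊗ₖ B) = cfc f A ⊗ₖ cfc f B := by
  let W : unitaryGroup (m × n) ℂ := ⟨_, kronecker_mem_unitary hA.1.eigenvectorUnitary.2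
    hB.1.eigenvectorUnitary.2⟩
  have hW (d : m → ℝ) (e : n → ℝ) :
      ((hA.1.eigenvectorUnitary : Matrix m m ℂ) * diagonal (fun i => (d i : ℂ)) *
        star (hA.1.eigenvectorUnitary : Matrix m m ℂ)) ⊗ₖ
      ((hB.1.eigenvectorUnitary : Matrix n n ℂ) * diagonal (fun i => (e i : ℂ)) *
        star (hB.1.eigenvectorUnitary : Matrix n n ℂ)) =
      (W : Matrix (m × n) (m × n) ℂ) * diagonal (fun p => ((d p.1 * e p.2 : ℝ) : ℂ)) *
        star (W : Matrix (m × n) (m × n) ℂ) := by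
    simp only [W, mul_kronecker_mul, diagonal_kronecker_diagonal, star_eq_conjTranspose,
      conjTranspose_kronecker, Complex.ofReal_mul]
  rw [hA.1.cfc_eq_unitary_conj_diagonal, hB.1.cfc_eq_unitary_conj_diagonal, hW]
  conv_lhs => rw [hA.1.eq_unitary_conj_diagonal, hB.1.eq_unitary_conj_diagonal, hW,
    cfc_unitary_conj_diagonal]
  simp only [hf _ _ (hA.eigenvalues_nonneg _) (hB.eigenvalues_nonneg _)]

theorem cfc_reindex (e : m ≃ n) {A : Matrix m m ℂ} (hA : A.IsHermitian) (f : ℝ → ℝ) :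
    cfc f (reindex e e A) = reindex e e (cfc f A) := by
  let φ : Matrix m m ℂ →⋆ₐ[ℂ] Matrix n n ℂ :=
    { (reindexAlgEquiv ℂ ℂ e).toAlgHom with map_star' := fun _ => rfl }
  exact (φ.map_cfc f A (continuousOn_spectrum A f)
    (φ.toLinearMap.continuous_of_finiteDimensional) hA (hA.submatrix e.symm)).symm

/-- The trace of a product of functions of two Hermitian matrices, in terms of the overlaps of
their eigenvectors. -/
theorem trace_cfc_mul_cfc {A B : Matrix m m ℂ} (hA : A.IsHermitian) (hB : B.IsHermitian)
    (f g : ℝ → ℝ) :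
    (cfc f A * cfc g B).trace.re = ∑ i, ∑ j, f (hA.eigenvalues i) * g (hB.eigenvalues j) *
      Complex.normSq ((star (hA.eigenvectorUnitary : Matrix m m ℂ) *
        (hB.eigenvectorUnitary : Matrix m m ℂ)) i j) := by
  rw [hA.cfc_eq_unitary_conj_diagonal, hB.cfc_eq_unitary_conj_diagonal]
  set U : Matrix m m ℂ := ↑hA.eigenvectorUnitary
  set V : Matrix m m ℂ := ↑hB.eigenvectorUnitary
  set F : Matrix m m ℂ := diagonal fun i => (f (hA.eigenvalues i) : ℂ) with hF
  set G : Matrix m m ℂ := diagonal fun i => (g (hB.eigenvalues i) : ℂ) with hG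
  have h : (U * F * star U * (V * G * star V)).trace =
      (F * (star U * V) * (G * star (star U * V))).trace := by
    rw [mul_assoc, mul_assoc, trace_mul_comm, star_mul, star_star]
    simp only [mul_assoc]
  rw [h, hF, hG]
  simp only [trace, diag, mul_apply (M := diagonal _ * (star U * V)), diagonal_mul, Complex.re_sum]
  refine Finset.sum_congr rfl fun i _ => Finset.sum_congr rfl fun j _ => ?_
  rw [star_apply]
  generalize (star U * V) i j = z
  simp [Complex.normSq_apply]
  ring

end Matrix

/-! ### Tensor powers and submultiplicativity -/

open Matrix

theorem trace_tensorOp {ι : Type*} [Fintype ι] {n k : ℕ} (A A' : TensorPowerOp ι n)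
    (B B' : TensorPowerOp ι k) :
    (tensorOp A B * tensorOp A' B').trace = (A * A').trace * (B * B').trace := by
  rw [tensorOp, tensorOp, reindex_apply, reindex_apply, submatrix_mul_equiv, ← mul_kronecker_mul,
    ← trace_kronecker]
  exact Equiv.sum_comp (Fin.appendEquiv n k).symm fun x => ((A * A') ⊗ₖ (B * B')) x x

theorem Matrix.PosSemidef.tensorOp {ι : Type*} [Fintype ι] {n k : ℕ}
    {A : TensorPowerOp ι n} {B : TensorPowerOp ι k}
    (hA : A.PosSemidef) (hB : B.PosSemidef) : (tensorOp A B).PosSemidef :=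
  (hA.kronecker hB).submatrix _

section tensor

variable {ι : Type*} [Fintype ι] [DecidableEq ι] {n k : ℕ}

theorem cfc_rpow_tensorOp {A : TensorPowerOp ι n} {B : TensorPowerOp ι k}
    (hA : A.PosSemidef) (hB : B.PosSemidef) (s : ℝ) :
    cfc (fun x : ℝ => x ^ s) (tensorOp A B) =
      tensorOp (cfc (fun x : ℝ => x ^ s) A) (cfc (fun x : ℝ => x ^ s) B) := by
  rw [tensorOp, cfc_reindex _ (hA.kronecker hB).1, cfc_kronecker hA hB, tensorOp]
  exact fun x y hx hy => Real.mul_rpow hx hy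

theorem cfc_rpow_smul {m : Type*} [Fintype m] [DecidableEq m] {A : Matrix m m ℂ} (hA : 0 ≤ A)
    {R : ℝ} (hR : 0 ≤ R) (s : ℝ) :
    cfc (fun x : ℝ => x ^ s) (R • A) = R ^ s • cfc (fun x : ℝ => x ^ s) A := by
  rw [← cfc_comp_smul R _ A ((A.finite_real_spectrum.image _).continuousOn _) (.of_nonneg hA),
    ← cfc_smul _ _ _ (continuousOn_spectrum A _)]
  exact cfc_congr fun x hx => Real.mul_rpow hR (spectrum_nonneg_of_nonneg hA hx)

/-- The quantity `Tr ρ_n ^ (1 - s) σ_n ^ s` is submultiplicative up to the factor `R` under upper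
factorization. -/
theorem trace_rpow_mul_rpow_le_pow {ρ σ : (n : ℕ) → TensorPowerOp ι n}
    (hρ : ∀ n, 1 ≤ n → (ρ n).PosSemidef) (hσ : ∀ n, 1 ≤ n → (σ n).PosSemidef)
    {R : ℝ} (hR : 1 ≤ R) (hρR : UpperFactorization R ρ) (hσR : UpperFactorization R σ)
    {s : ℝ} (hs : s ∈ Set.Icc (0 : ℝ) 1) {n : ℕ} (hn : 1 ≤ n) :
    (cfc (fun x : ℝ => x ^ (1 - s)) (ρ n) * cfc (fun x : ℝ => x ^ s) (σ n)).trace.re ≤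
      R ^ n * (cfc (fun x : ℝ => x ^ (1 - s)) (ρ 1) *
        cfc (fun x : ℝ => x ^ s) (σ 1)).trace.re ^ n := by
  have hs' : 1 - s ∈ Set.Icc (0 : ℝ) 1 := ⟨by linarith [hs.2], by linarith [hs.1]⟩
  have hR0 : 0 ≤ R := zero_le_one.trans hR
  have h0 {n k : ℕ} {A : TensorPowerOp ι n} {B : TensorPowerOp ι k} (hA : A.PosSemidef)
      (hB : B.PosSemidef) : 0 ≤ tensorOp A B := nonneg_iff_posSemidef.mpr (hA.tensorOp hB)
  set q : ℕ → ℝ := fun n =>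
    (cfc (fun x : ℝ => x ^ (1 - s)) (ρ n) * cfc (fun x : ℝ => x ^ s) (σ n)).trace.re with hq
  have hq0 {n : ℕ} (hn : 1 ≤ n) : 0 ≤ q n :=
    trace_mul_re_nonneg (cfc_rpow_nonneg (hρ n hn).nonneg _) (cfc_rpow_nonneg (hσ n hn).nonneg _)
  change q n ≤ R ^ n * q 1 ^ n
  induction n, hn using Nat.le_induction with
  -- The factor `R` is not needed for one copy; `R ≥ 1` absorbs it.
  | base => simpa using le_mul_of_one_le_left (hq0 le_rfl) hR
  | succ n hn ih =>
    have hstep : q (n + 1) ≤ R * (q n * q 1) := by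
      have hρ1 := cfc_rpow_le_cfc_rpow (hρ (n + 1) (by omega)).nonneg (hρR n hn) hs'
      have hσ1 := cfc_rpow_le_cfc_rpow (hσ (n + 1) (by omega)).nonneg (hσR n hn) hs
      have h1 := trace_mul_re_mono_left hρ1 (cfc_rpow_nonneg (hσ (n + 1) (by omega)).nonneg s)
      have h2 := trace_mul_re_mono_right hσ1 ((cfc_rpow_nonneg (hρ (n + 1) (by omega)).nonneg
        (1 - s)).trans hρ1)
      refine (h1.trans h2).trans_eq ?_
      -- The two scalars combine to `R^(1-s) R^s = R`.
      rw [cfc_rpow_smul (h0 (hρ n hn) (hρ 1 le_rfl)) hR0,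
        cfc_rpow_smul (h0 (hσ n hn) (hσ 1 le_rfl)) hR0,
        cfc_rpow_tensorOp (hρ n hn) (hρ 1 le_rfl), cfc_rpow_tensorOp (hσ n hn) (hσ 1 le_rfl),
        smul_mul_smul_comm, ← Real.rpow_add (by linarith), sub_add_cancel, Real.rpow_one,
        trace_smul, trace_tensorOp, Complex.real_smul, Complex.re_ofReal_mul, Complex.mul_re]
      -- The trace of a product of two self-adjoint matrices is real, so taking real parts respects
      -- the product of traces.
      have him {n : ℕ} (hn : 1 ≤ n) : (cfc (fun x : ℝ => x ^ (1 - s)) (ρ n) *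
          cfc (fun x : ℝ => x ^ s) (σ n)).trace.im = 0 := by
        rw [← Complex.conj_eq_iff_im, ← Complex.star_def, ← trace_conjTranspose, conjTranspose_mul,
          (cfc_predicate _ (σ n) : IsSelfAdjoint _).isHermitian.eq,
          (cfc_predicate _ (ρ n) : IsSelfAdjoint _).isHermitian.eq, trace_mul_comm]
      rw [him hn, zero_mul, sub_zero]
    calc q (n + 1) ≤ R * (q n * q 1) := hstep
      _ ≤ R * (R ^ n * q 1 ^ n * q 1) := by gcongr; exact hq0 le_rfl
      _ = R ^ (n + 1) * q 1 ^ (n + 1) := by ring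

end tensor

/-! ### Relative modular operator and the one-copy bound -/

section modular

variable {m : Type*} [Fintype m] [DecidableEq m] {ρ σ : Matrix m m ℂ}

theorem relModular_symm_apply (σ ρ X : Matrix m m ℂ) :
    relModular σ ρ ((HilbertSchmidt.equivMatrix m).symm X) =
      (HilbertSchmidt.equivMatrix m).symm (σ * (X * ρ⁻¹)) := rfl

/-- Cyclicity of the trace. Without self-adjointness `cfc Real.log` would take its default value
`0`. -/
theorem isSelfAdjoint_relModular (hρ : ρ.IsHermitian) (hσ : σ.IsHermitian) :
    IsSelfAdjoint (relModular σ ρ) := by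
  rw [ContinuousLinearMap.isSelfAdjoint_iff_isSymmetric]
  intro x y
  obtain ⟨X, rfl⟩ := (HilbertSchmidt.equivMatrix m).symm.surjective x
  obtain ⟨Y, rfl⟩ := (HilbertSchmidt.equivMatrix m).symm.surjective y
  simp only [ContinuousLinearMap.coe_coe, relModular_symm_apply]
  rw [HilbertSchmidt.inner_eq_trace, HilbertSchmidt.inner_eq_trace, conjTranspose_mul,
    conjTranspose_mul, hσ.eq, conjTranspose_nonsing_inv, hρ.eq, mul_assoc, mul_assoc,
    trace_mul_comm]
  simp only [mul_assoc]

theorem finite_real_spectrum_relModular (σ ρ : Matrix m m ℂ) :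
    (spectrum ℝ (relModular σ ρ)).Finite := by
  have h : (spectrum ℂ (relModular σ ρ)).Finite :=
    (Module.End.finite_spectrum (relModular σ ρ).toLinearMap).subset
      (AlgHom.spectrum_apply_subset
        (Module.End.toContinuousLinearMap (𝕜 := ℂ) (HilbertSchmidt m)).toAlgHom
        (relModular σ ρ).toLinearMap)
  rw [← spectrum.preimage_algebraMap ℂ]
  exact h.preimage (FaithfulSMul.algebraMap_injective ℝ ℂ).injOn

/-- The rank-one operator `|v_j⟩⟨u_i|` is an eigenvector: `σ` acts on the left by `b_j`, `ρ⁻¹` on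
the right by `1 / a_i`. -/
theorem div_eigenvalues_mem_spectrum_relModular (hρ : ρ.PosDef) (hσ : σ.IsHermitian) (i j : m) :
    hσ.eigenvalues j / hρ.1.eigenvalues i ∈ spectrum ℝ (relModular σ ρ) := by
  set U : Matrix m m ℂ := ↑hρ.1.eigenvectorUnitary with hU
  set V : Matrix m m ℂ := ↑hσ.eigenvectorUnitary with hV
  set a := hρ.1.eigenvalues with ha
  set b := hσ.eigenvalues with hb
  have hUU : star U * U = 1 := Unitary.coe_star_mul_self _
  have hVV : star V * V = 1 := Unitary.coe_star_mul_self _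
  have hρU : star U * ρ = diagonal (fun i => (a i : ℂ)) * star U := by
    conv_lhs => rw [hρ.1.eq_unitary_conj_diagonal, ← hU, ← mul_assoc, ← mul_assoc, hUU, one_mul]
  have hσV : σ * V = V * diagonal (fun i => (b i : ℂ)) := by
    conv_lhs => rw [hσ.eq_unitary_conj_diagonal, ← hV, mul_assoc, hVV, mul_one]
  have hinv : star U * ρ⁻¹ = diagonal (fun i => (a i : ℂ)⁻¹) * star U := by
    have h1 : (diagonal fun i => (a i : ℂ)⁻¹) * (diagonal fun i => (a i : ℂ)) = 1 := by
      rw [diagonal_mul_diagonal, ← diagonal_one]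
      congr 1
      ext i
      exact inv_mul_cancel₀ (Complex.ofReal_ne_zero.mpr (hρ.eigenvalues_pos i).ne')
    have h2 : star U = diagonal (fun i => (a i : ℂ)⁻¹) * star U * ρ := by
      rw [mul_assoc, hρU, ← mul_assoc, h1, one_mul]
    conv_lhs => rw [h2]
    rw [mul_assoc, mul_nonsing_inv _ ((isUnit_iff_isUnit_det _).mp hρ.isUnit), mul_one]
  set X : Matrix m m ℂ := V * single j i 1 * star U with hX
  have hX0 : X ≠ 0 := by
    intro h
    have h1 : star V * X * U = single j i 1 := by
      rw [hX]
      simp only [mul_assoc, hUU, mul_one]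
      rw [← mul_assoc, hVV, one_mul]
    rw [h, mul_zero, zero_mul] at h1
    simpa using congrFun (congrFun h1 j) i
  have hΔX : σ * (X * ρ⁻¹) = ((b j / a i : ℝ) : ℂ) • X := by
    rw [hX, mul_assoc, hinv]
    simp only [← mul_assoc]
    have h1 : (diagonal fun i => (b i : ℂ)) * single j i 1 * (diagonal fun i => (a i : ℂ)⁻¹) =
        ((b j / a i : ℝ) : ℂ) • single j i 1 := by
      ext k l
      rw [mul_diagonal, diagonal_mul, Matrix.smul_apply, single_apply]
      split_ifs with h
      · rw [← h.1, ← h.2]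
        simp [div_eq_mul_inv]
      · simp
    rw [hσV, mul_assoc V, mul_assoc V, h1, mul_smul_comm, smul_mul_assoc]
  intro hunit
  obtain ⟨u, hu⟩ := hunit
  have hker : (u : HilbertSchmidt m →L[ℂ] HilbertSchmidt m)
      ((HilbertSchmidt.equivMatrix m).symm X) = 0 := by
    rw [hu, _root_.sub_apply, relModular_symm_apply, hΔX, map_smul, Algebra.algebraMap_eq_smul_one,
      _root_.smul_apply, one_apply_eq_self, Complex.coe_smul, sub_self]
  refine hX0 ((HilbertSchmidt.equivMatrix m).symm.map_eq_zero_iff.mp ?_)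
  have := congrArg (fun x => (u⁻¹ : (HilbertSchmidt m →L[ℂ] HilbertSchmidt m)ˣ).1 x) hker
  simpa [← mul_apply_eq_comp] using this

/-- The log-likelihood ratios of the eigenvalues deviate from their mean by at most
`modularDeviation`. -/
theorem abs_log_div_add_relEntropy_le (hρ : ρ.PosDef) (hσ : σ.IsHermitian) (i j : m) :
    |Real.log (hσ.eigenvalues j / hρ.1.eigenvalues i) + relEntropy ρ σ| ≤
      modularDeviation ρ σ := by
  have hsa := isSelfAdjoint_relModular hρ.1 hσ
  have h := norm_apply_le_norm_cfc (fun x => Real.log x + relEntropy ρ σ) (relModular σ ρ)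
    (div_eigenvalues_mem_spectrum_relModular hρ hσ i j)
    ((finite_real_spectrum_relModular σ ρ).continuousOn _) hsa
  rw [cfc_add_const _ _ _ ((finite_real_spectrum_relModular σ ρ).continuousOn _) hsa] at h
  rw [modularDeviation]
  convert! h using 3

/-- Hoeffding's lemma for a finitely supported centred random variable. -/
theorem sum_mul_exp_le_of_abs_le {κ : Type*} [Fintype κ] {p x : κ → ℝ} (hp : ∀ i, 0 ≤ p i)
    (hp1 : ∑ i, p i = 1) (hmean : ∑ i, p i * x i = 0) {c : ℝ} (hc : ∀ i, |x i| ≤ c) (s : ℝ) :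
    ∑ i, p i * Real.exp (s * x i) ≤ Real.exp (s ^ 2 * c ^ 2 / 2) := by
  obtain ⟨i₀⟩ : Nonempty κ := by
    by_contra h
    rw [not_nonempty_iff] at h
    simp at hp1
  rcases ((abs_nonneg _).trans (hc i₀)).eq_or_lt with h0 | h0
  · have hx (i : κ) : x i = 0 := abs_nonpos_iff.mp (h0 ▸ hc i)
    simp [hx, hp1, ← h0]
  -- Convexity puts `exp` below its chord over `[-sc, sc]`; averaging kills the linear term and
  -- leaves `cosh (s c)`.
  have hconv (i : κ) : Real.exp (s * x i) ≤
      Real.cosh (s * c) + x i * (Real.sinh (s * c) / c) := by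
    have hi := abs_le.mp (hc i)
    have h := convexOn_exp.2 (Set.mem_univ (s * c)) (Set.mem_univ (-(s * c)))
      (show 0 ≤ (c + x i) / (2 * c) from div_nonneg (by linarith) (by linarith))
      (show 0 ≤ (c - x i) / (2 * c) from div_nonneg (by linarith) (by linarith))
      (by field_simp; ring)
    simp only [smul_eq_mul] at h
    convert! h using 1
    · congr 1
      field_simp
      ring
    · rw [Real.cosh_eq, Real.sinh_eq]
      field_simp
      ring
  calc ∑ i, p i * Real.exp (s * x i)
      ≤ ∑ i, p i * (Real.cosh (s * c) + x i * (Real.sinh (s * c) / c)) :=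
        Finset.sum_le_sum fun i _ => mul_le_mul_of_nonneg_left (hconv i) (hp i)
    _ = (∑ i, p i) * Real.cosh (s * c) + (∑ i, p i * x i) * (Real.sinh (s * c) / c) := by
        rw [Finset.sum_mul, Finset.sum_mul, ← Finset.sum_add_distrib]
        exact Finset.sum_congr rfl fun i _ => by ring
    _ = Real.cosh (s * c) := by rw [hp1, hmean]; ring
    _ ≤ Real.exp (s ^ 2 * c ^ 2 / 2) := by
        simpa only [mul_pow] using Real.cosh_le_exp_half_sq (s * c)

/-- In eigenbases the trace is the mean of `(b_j / a_i)^s` under the weights `a_i |⟨u_i, v_j⟩|²`;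
Hoeffding's lemma applies to `log (b_j / a_i) + D`, which is centred. -/
theorem trace_rpow_mul_rpow_le_exp (hρ : IsFaithfulState ρ) (hσ : σ.PosDef) (s : ℝ) :
    (cfc (fun x : ℝ => x ^ (1 - s)) ρ * cfc (fun x : ℝ => x ^ s) σ).trace.re ≤
      Real.exp (-(s * relEntropy ρ σ) + s ^ 2 * modularDeviation ρ σ ^ 2 / 2) := by
  have hρ0 := hρ.posDef
  have hρs : IsSelfAdjoint ρ := hρ0.1
  have hσs : IsSelfAdjoint σ := hσ.1
  set a := hρ0.1.eigenvalues with ha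
  set b := hσ.1.eigenvalues with hb
  set w : m × m → ℝ := fun p => Complex.normSq
    ((star (hρ0.1.eigenvectorUnitary : Matrix m m ℂ) *
        (hσ.1.eigenvectorUnitary : Matrix m m ℂ)) p.1 p.2) with hw
  have ha0 (i : m) : 0 < a i := hρ0.eigenvalues_pos i
  have hb0 (j : m) : 0 < b j := hσ.eigenvalues_pos j
  have htr (f g : ℝ → ℝ) : (cfc f ρ * cfc g σ).trace.re =
      ∑ p : m × m, f (a p.1) * g (b p.2) * w p := by
    rw [trace_cfc_mul_cfc hρ0.1 hσ.1, Fintype.sum_prod_type]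
  have hp1 : ∑ p : m × m, a p.1 * w p = 1 := by
    have h := htr (fun x => x) (fun _ => 1)
    rw [cfc_id' ℝ ρ hρs, cfc_const_one ℝ σ hσs, mul_one, hρ.trace_eq_one] at h
    simpa using h.symm
  have hent : relEntropy ρ σ =
      ∑ p : m × m, a p.1 * w p * (Real.log (a p.1) - Real.log (b p.2)) := by
    have h1 := htr (fun x => x) Real.log
    have h2 := htr (fun x => x * Real.log x) (fun _ => 1)
    rw [cfc_const_one ℝ σ hσs, mul_one, cfc_mul _ _ _ (continuousOn_spectrum ρ _)
      (continuousOn_spectrum ρ _), cfc_id' ℝ ρ hρs] at h2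
    rw [cfc_id' ℝ ρ hρs] at h1
    rw [relEntropy, mul_sub, trace_sub, Complex.sub_re, h1, h2, ← Finset.sum_sub_distrib]
    exact Finset.sum_congr rfl fun p _ => by ring
  set D := relEntropy ρ σ
  have hmean : ∑ p : m × m, a p.1 * w p * (Real.log (b p.2 / a p.1) + D) = 0 := by
    simp only [mul_add, Finset.sum_add_distrib, ← Finset.sum_mul, hp1, one_mul]
    rw [hent, ← Finset.sum_add_distrib]
    refine Finset.sum_eq_zero fun p _ => ?_
    rw [Real.log_div (hb0 _).ne' (ha0 _).ne']
    ring
  have hmain := sum_mul_exp_le_of_abs_le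
    (fun p : m × m => mul_nonneg (ha0 p.1).le (Complex.normSq_nonneg _)) hp1 hmean
    (fun p => abs_log_div_add_relEntropy_le hρ0 hσ.1 p.1 p.2) s
  rw [htr, Real.exp_add]
  calc _ = ∑ p : m × m, Real.exp (-(s * D)) *
        (a p.1 * w p * Real.exp (s * (Real.log (b p.2 / a p.1) + D))) := by
        refine Finset.sum_congr rfl fun p _ => ?_
        rw [mul_add, Real.exp_add, mul_comm s (Real.log _), Real.exp_mul,
          Real.exp_log (div_pos (hb0 _) (ha0 _)), Real.div_rpow (hb0 _).le (ha0 _).le,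
          Real.rpow_sub (ha0 _), Real.rpow_one, Real.exp_neg]
        have := (Real.rpow_pos_of_pos (ha0 p.1) s).ne'
        field_simp
    _ ≤ _ := by
        rw [← Finset.mul_sum]
        exact mul_le_mul_of_nonneg_left hmain (Real.exp_nonneg _)

end modular

/-! ### From Audenaert's inequality to the Stein error -/

section errors

variable {m : Type*} [Fintype m] [DecidableEq m]

theorem steinError_le_typeIIError {ρ σ T : Matrix m m ℂ} {ε : ℝ} (hσ : 0 ≤ σ) (hT0 : 0 ≤ T)
    (hT1 : T ≤ 1) (hT : typeIError ρ T ≤ ε) : steinError ρ σ ε ≤ typeIIError σ T := by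
  refine csInf_le ⟨0, ?_⟩ ⟨T, hT0, hT1, hT, rfl⟩
  rintro _ ⟨T', hT'0, -, -, rfl⟩
  exact trace_mul_re_nonneg hT'0 hσ

/-- The trivial test `T = 0`. It settles `ε = 1`, where `log (R^n / ε)` can vanish and the optimal
`s` would be `0`. -/
theorem steinError_one_nonpos {ρ σ : Matrix m m ℂ} (hρ : IsFaithfulState ρ) (hσ : 0 ≤ σ) :
    steinError ρ σ 1 ≤ 0 := by
  refine (steinError_le_typeIIError (T := 0) hσ le_rfl zero_le_one ?_).trans_eq ?_
  · simp [typeIError, hρ.trace_eq_one]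
  · simp [typeIIError]

/-- Audenaert's inequality for `ρ` and `exp (-y) σ`, as a bound on the Stein error. -/
theorem steinError_le_exp {ρ σ : Matrix m m ℂ} (hρ : 0 ≤ ρ) (hσ : 0 ≤ σ) {ε s y : ℝ}
    (hε : ε ≤ 1) (hs : s ∈ Set.Icc (0 : ℝ) 1)
    (h : Real.exp (-(s * y)) *
      (cfc (fun x : ℝ => x ^ (1 - s)) ρ * cfc (fun x : ℝ => x ^ s) σ).trace.re ≤ ε) :
    steinError ρ σ ε ≤ Real.exp y := by
  have hy := Real.exp_pos (-y)
  obtain ⟨T, hT0, hT1, hT⟩ := exists_test_error_le hρ (smul_nonneg hy.le hσ) hs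
  rw [cfc_rpow_smul hσ hy.le, mul_smul_comm, mul_smul_comm, trace_smul, trace_smul,
    Complex.real_smul, Complex.real_smul, Complex.re_ofReal_mul, Complex.re_ofReal_mul,
    ← Real.exp_mul, neg_mul, mul_comm y s] at hT
  replace hT := hT.trans h
  have h1 : 0 ≤ ((1 - T) * ρ).trace.re := trace_mul_re_nonneg (sub_nonneg.mpr hT1) hρ
  have h2 : 0 ≤ (T * σ).trace.re := trace_mul_re_nonneg hT0 hσ
  -- Both summands in `hT` are nonnegative, so each is at most `ε`; in the second, `ε` is relaxed to
  -- `1`.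
  refine (steinError_le_typeIIError hσ hT0 hT1 ?_).trans ?_
  · exact (le_add_of_nonneg_right (mul_nonneg hy.le h2)).trans hT
  · have h3 : Real.exp (-y) * (T * σ).trace.re ≤ 1 := by linarith
    rwa [Real.exp_neg, inv_mul_le_iff₀ (Real.exp_pos y), mul_one] at h3

end errors

/-! ### Optimization over `s` -/

section bounds

variable {ι : Type*} [Fintype ι] [DecidableEq ι] {ρ σ : (n : ℕ) → TensorPowerOp ι n} {R : ℝ} {n : ℕ}

/-- The bound on the Stein error before optimizing over the parameter `s`. -/
theorem steinError_le_exp_of_upperFactorization (hρ : ∀ n, 1 ≤ n → IsFaithfulState (ρ n))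
    (hσ : ∀ n, 1 ≤ n → IsFaithfulState (σ n)) (hR : 1 ≤ R) (hρR : UpperFactorization R ρ)
    (hσR : UpperFactorization R σ) (hn : 1 ≤ n) {ε s : ℝ} (hε : 0 < ε) (hε1 : ε ≤ 1)
    (hs0 : 0 < s) (hs1 : s ≤ 1) :
    steinError (ρ n) (σ n) ε ≤ Real.exp (-(n * relEntropy (ρ 1) (σ 1)) +
      n * s * modularDeviation (ρ 1) (σ 1) ^ 2 / 2 + Real.log (R ^ n * ε⁻¹) / s) := by
  have hs : s ∈ Set.Icc (0 : ℝ) 1 := ⟨hs0.le, hs1⟩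
  have hRn : 0 < R ^ n := by positivity
  -- The exponent in the goal is the `y` solving `exp (-s y) R^n exp (n (-s D + s² c² / 2)) = ε`.
  refine steinError_le_exp (hρ n hn).posDef.posSemidef.nonneg (hσ n hn).posDef.posSemidef.nonneg
    hε1 hs ?_
  have h1 := trace_rpow_mul_rpow_le_pow (fun n hn => (hρ n hn).posDef.posSemidef)
    (fun n hn => (hσ n hn).posDef.posSemidef) hR hρR hσR hs hn
  have h2 := trace_rpow_mul_rpow_le_exp (hρ 1 le_rfl) (hσ 1 le_rfl).posDef s
  have h0 := trace_mul_re_nonneg (cfc_rpow_nonneg (hρ 1 le_rfl).posDef.posSemidef.nonneg (1 - s))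
    (cfc_rpow_nonneg (hσ 1 le_rfl).posDef.posSemidef.nonneg s)
  have h3 := h1.trans (mul_le_mul_of_nonneg_left (pow_le_pow_left₀ h0 h2 n) hRn.le)
  refine (mul_le_mul_of_nonneg_left h3 (Real.exp_pos _).le).trans_eq ?_
  rw [← Real.exp_nat_mul, mul_left_comm, ← Real.exp_add]
  rw [mul_comm, ← eq_div_iff hRn.ne', ← Real.exp_log (div_pos hε hRn)]
  have h4 : Real.log (ε / R ^ n) = -Real.log (R ^ n * ε⁻¹) := by
    rw [← Real.log_inv, mul_inv, inv_inv, mul_comm, ← div_eq_mul_inv]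
  rw [h4]
  congr 1
  field_simp
  ring

/-- `n s c² / 2 + L / s` is minimal at `s = √(2 n L) / (n c)`, with value `c √(2 n L)`; the
assumption on `L` says that this `s` is at most `1`. -/
theorem steinError_le_of_le (hρ : ∀ n, 1 ≤ n → IsFaithfulState (ρ n))
    (hσ : ∀ n, 1 ≤ n → IsFaithfulState (σ n)) (hR : 1 ≤ R) (hρR : UpperFactorization R ρ)
    (hσR : UpperFactorization R σ) (hn : 1 ≤ n) {ε : ℝ} (hε : 0 < ε) (hε1 : ε ≤ 1)
    (h : Real.log (R ^ n * ε⁻¹) ≤ n * modularDeviation (ρ 1) (σ 1) ^ 2 / 2) :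
    steinError (ρ n) (σ n) ε ≤ Real.exp (-(n * relEntropy (ρ 1) (σ 1)) +
      modularDeviation (ρ 1) (σ 1) * Real.sqrt (2 * n * Real.log (R ^ n * ε⁻¹))) := by
  have hn0 : (0 : ℝ) < n := by exact_mod_cast hn
  have hRn : 1 ≤ R ^ n := one_le_pow₀ hR
  have hc0 : 0 ≤ modularDeviation (ρ 1) (σ 1) := norm_nonneg _
  rcases hε1.eq_or_lt with rfl | hε1'
  · exact (steinError_one_nonpos (hρ n hn) (hσ n hn).posDef.posSemidef.nonneg).trans
      (Real.exp_nonneg _)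
  have hL : 0 < Real.log (R ^ n * ε⁻¹) :=
    Real.log_pos (one_lt_mul_of_le_of_lt hRn ((one_lt_inv₀ hε).mpr hε1'))
  have hbound (s : ℝ) (hs0 : 0 < s) (hs1 : s ≤ 1) :=
    steinError_le_exp_of_upperFactorization hρ hσ hR hρR hσR hn hε hε1 hs0 hs1
  set L := Real.log (R ^ n * ε⁻¹)
  set c := modularDeviation (ρ 1) (σ 1)
  -- If `c = 0`, the assumption would force `L ≤ 0`.
  have hc : 0 < c := by
    refine hc0.lt_of_ne fun h0 => ?_
    rw [← h0] at h
    simp only [ne_eq, OfNat.ofNat_ne_zero, not_false_eq_true, zero_pow, mul_zero, zero_div] at h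
    linarith
  set q := Real.sqrt (2 * n * L) with hq
  have hq0 : 0 < q := Real.sqrt_pos.mpr (by positivity)
  have hq2 : q ^ 2 = 2 * n * L := Real.sq_sqrt (by positivity)
  have hqc : q ≤ n * c := Real.sqrt_le_iff.mpr ⟨by positivity, by nlinarith⟩
  refine (hbound (q / (n * c)) (by positivity) ((div_le_one (by positivity)).mpr hqc)).trans_eq ?_
  rw [add_assoc]
  congr 2
  have hL' : L = q ^ 2 / (2 * n) := by rw [hq2]; field_simp
  rw [hL']
  field_simp
  ring

/-- The endpoint `s = 1`. The bound holds in both regimes, but is the best choice of `s` only when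
the interior minimum exceeds `1`. -/
theorem steinError_le_exp_half_sq (hρ : ∀ n, 1 ≤ n → IsFaithfulState (ρ n))
    (hσ : ∀ n, 1 ≤ n → IsFaithfulState (σ n)) (hR : 1 ≤ R) (hρR : UpperFactorization R ρ)
    (hσR : UpperFactorization R σ) (hn : 1 ≤ n) {ε : ℝ} (hε : 0 < ε) (hε1 : ε ≤ 1) :
    steinError (ρ n) (σ n) ε ≤ Real.exp (-(n * relEntropy (ρ 1) (σ 1)) +
      n * modularDeviation (ρ 1) (σ 1) ^ 2 / 2 + Real.log (R ^ n * ε⁻¹)) := by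
  simpa using steinError_le_exp_of_upperFactorization hρ hσ hR hρR hσR hn hε hε1 one_pos le_rfl

end bounds

theorem mainTheorem1 {ι : Type*} [Fintype ι] [DecidableEq ι]
    (ρ σ : (n : ℕ) → TensorPowerOp ι n)
    (hρ : ∀ n : ℕ, 1 ≤ n → IsFaithfulState (ρ n))
    (hσ : ∀ n : ℕ, 1 ≤ n → IsFaithfulState (σ n))
    (R : ℝ) (hR : 1 ≤ R)
    (hρR : UpperFactorization R ρ) (hσR : UpperFactorization R σ)
    (D c : ℝ) (hD : D = relEntropy (ρ 1) (σ 1)) (hc : c = modularDeviation (ρ 1) (σ 1))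
    (n : ℕ) (hn : 1 ≤ n) :
    (∀ ε : ℝ, 0 < ε → ε ≤ 1 →
      (R ^ n * Real.exp (-(n * c ^ 2 / 2)) ≤ ε →
        steinError (ρ n) (σ n) ε
          ≤ Real.exp (-(n * D) + c * Real.sqrt (2 * n * Real.log (R ^ n * ε⁻¹)))) ∧
      (ε < R ^ n * Real.exp (-(n * c ^ 2 / 2)) →
        steinError (ρ n) (σ n) ε
          ≤ Real.exp (-(n * D) + n * c ^ 2 / 2 + Real.log (R ^ n * ε⁻¹)))) ∧
    (∀ r : ℝ, 0 < r →
      (r ≤ c ^ 2 / 2 - Real.log R →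
        hoeffdingError n (ρ n) (σ n) r
          ≤ Real.exp (-(n * D) + n * c * Real.sqrt (2 * (r + Real.log R)))) ∧
      (c ^ 2 / 2 - Real.log R < r →
        hoeffdingError n (ρ n) (σ n) r
          ≤ Real.exp (-(n * (D - c ^ 2 / 2 - r - Real.log R))))) := by
  subst hD hc
  have hn0 : (0 : ℝ) < n := by exact_mod_cast hn
  have hRpos : 0 < R := by linarith
  refine ⟨fun ε hε hε1 => ⟨fun h => ?_, fun _ =>
    steinError_le_exp_half_sq hρ hσ hR hρR hσR hn hε hε1⟩, fun r hr => ?_⟩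
  · refine steinError_le_of_le hρ hσ hR hρR hσR hn hε hε1 ?_
    rw [Real.log_le_iff_le_exp (by positivity), ← div_eq_mul_inv, div_le_iff₀ hε]
    rwa [Real.exp_neg, ← div_eq_mul_inv, div_le_iff₀ (Real.exp_pos _), mul_comm ε] at h
  · have hε1 : Real.exp (-(n * r)) ≤ 1 := Real.exp_le_one_iff.mpr (by nlinarith)
    -- The Hoeffding error is by definition the Stein error at `ε = exp (-n r)`, for which `L = n (r
    -- + log R)`.
    have hL : Real.log (R ^ n * (Real.exp (-(n * r)))⁻¹) = n * (r + Real.log R) := by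
      rw [← Real.exp_neg, neg_neg, Real.log_mul (by positivity) (Real.exp_ne_zero _),
        Real.log_pow, Real.log_exp]
      ring
    refine ⟨fun h => ?_, fun _ => ?_⟩
    · refine (steinError_le_of_le hρ hσ hR hρR hσR hn (Real.exp_pos _) hε1 ?_).trans_eq ?_
      · rw [hL]
        nlinarith
      · rw [hL, show 2 * (n : ℝ) * (n * (r + Real.log R)) = n ^ 2 * (2 * (r + Real.log R)) by ring,
          Real.sqrt_mul (by positivity), Real.sqrt_sq hn0.le]
        congr 2
        ring
    · refine (steinError_le_exp_half_sq hρ hσ hR hρR hσR hn (Real.exp_pos _) hε1).trans_eq ?_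
      rw [hL]
      congr 1
      ring
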